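/- Fix $n$ and write permutations of $[n]$ in one-line notation; $s_i=(i,i+1)$, and $s_i\circ w$ is $s_iw$ if $i$ occurs before $i+1$ in $w$ and $w$ otherwise, while $w\circ s_i$ is $ws_i$ if $w(i)<w(i+1)$ and $w$ otherwise. Let $\mu=(\mu_1,\dots,\mu_k)$ be a composition of $n$. A permutation $\pi\in S_n$ is a *$\mu$-involution* if, when its one-line notation is cut into consecutive blocks of sizes $\mu_1,\dots,\mu_k$, the standardization of each block is an involution; $\mathcal I_\mu$ is the set of $\mu$-involutions. Put $\pi\circ_\mu s_i=s_i\circ\pi$ if $i,i+1$ lie in different blocks of $\pi$. If both lie in the same block $B=\pi(m+1)\cdots\pi(m+|B|)$ and $r$ is the rank of $i$ among the letters of $B$, put $\pi\circ_\mu s_i=s_i\circ\pi\circ s_{m+r}$. A *reduced $\mu$-word* of $\pi$ is a word $(a_1,\dots,a_p)$ of minimal length with $\pi=e\circ_\mu s_{a_1}\circ_\mu\cdots\circ_\mu s_{a_p}$ (performed from left to right). The set $\mathcal A_\mu(\pi)\subseteq S_n$ of *$\mu$-atoms* of $\pi$ consists of the permutations having a reduced word that is a reduced $\mu$-word of $\pi$;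 the set of *inverse $\mu$-atoms* is $\mathcal A_\mu^{-1}(\pi)=\{w^{-1}:w\in\mathcal A_\mu(\pi)\}$. Let $$\mathfrak S^\mu_\pi=\sum_{w\in\mathcal A_\mu(\pi)}\mathfrak S_w,$$ where the Schubert polynomials $\mathfrak S_w\in\mathbb Z[x_1,\dots,x_n]$ are given by $\mathfrak S_{n\cdots 21}=x_1^{n-1}x_2^{n-2}\cdots x_{n-1}$ and $\mathfrak S_w=\partial_i\mathfrak S_{ws_i}$ if $w(i)<w(i+1)$, with $\partial_i f=(f-s_if)/(x_i-x_{i+1})$. A composition $\nu$ of $n$ *refines* $\mu$ if every partial sum $\mu_1+\dots+\mu_j$ is a partial sum of $\nu$. For $\tau\in\mathcal I_\nu$ and $\pi\in\mathcal I_\mu$, write $\tau\le_{\mathcal A}\pi$ if $\nu$ refines $\mu$ and $\mathcal A_\nu(\tau)\subseteq\mathcal A_\mu(\pi)$. **Theorem.** Let $\mu,\nu$ be compositions of $n$ such that $\nu$ refines $\mu$, and let $\pi\in\mathcal I_\mu$. Then $$\mathfrak S^\mu_\pi=\sum_{\tau\in\mathcal I_\nu,\ \tau\le_{\mathcal A}\pi}\mathfrak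 S^\nu_\tau ,$$ and the inverse $\mu$-atoms of $\pi$ split disjointly: $$\mathcal A_\mu^{-1}(\pi)=\bigsqcup_{\tau\in\mathcal I_\nu,\ \tau\le_{\mathcal A}\pi}\mathcal A_\nu^{-1}(\tau).$$ -/

import Mathlib

open scoped BigOperators

noncomputable section

namespace MuInv

/-! ### Simple transpositions, words, and the 0-Hecke product

Everything is 0-indexed: the symbols `1, …, n` are the elements of `Fin n`, and the simple
transpositions `s_1, …, s_{n-1}` are indexed by `Fin (n - 1)`. -/

/-- The smaller of the two symbols exchanged by the `i`-th simple transposition. -/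
def lo {n : ℕ} (i : Fin (n - 1)) : Fin n := ⟨i, by have := i.isLt; omega⟩

/-- The larger of the two symbols exchanged by the `i`-th simple transposition. -/
def hi {n : ℕ} (i : Fin (n - 1)) : Fin n := ⟨i + 1, by have := i.isLt; omega⟩

/-- The simple transposition `s_i`. -/
def simple {n : ℕ} (i : Fin (n - 1)) : Equiv.Perm (Fin n) := Equiv.swap (lo i) (hi i)

/-- The product `s_{a_1} ⋯ s_{a_p}` in the symmetric group. -/
def wordProd {n : ℕ} (a : List (Fin (n - 1))) : Equiv.Perm (Fin n) := (a.map simple).prod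

/-- The set `R(w)` of reduced words of `w`: words for `w` of minimal length. -/
def reducedWords {n : ℕ} (w : Equiv.Perm (Fin n)) : Set (List (Fin (n - 1))) :=
  {a | wordProd a = w ∧ ∀ b : List (Fin (n - 1)), wordProd b = w → a.length ≤ b.length}

/-- The 0-Hecke product `w ∘ s_i`: it is `w s_i` if `w s_i > w`, i.e. if `w(i) < w(i+1)`,
and `w` otherwise. -/
def heckeRight {n : ℕ} (w : Equiv.Perm (Fin n)) (i : Fin (n - 1)) : Equiv.Perm (Fin n) :=
  if w (lo i) < w (hi i) then w * simple i else w

/-- The 0-Hecke product `s_i ∘ w`: it is `s_i w` if `s_i w > w`, i.e. if `i` occurs before `i+1`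
in the one-line notation of `w`, and `w` otherwise. -/
def heckeLeft {n : ℕ} (i : Fin (n - 1)) (w : Equiv.Perm (Fin n)) : Equiv.Perm (Fin n) :=
  if w⁻¹ (lo i) < w⁻¹ (hi i) then simple i * w else w

/-! ### Blocks, standardization and `μ`-involutions -/

/-- The standardization of a word with distinct letters: the permutation with the same relative
order. (`Tuple.sort f` is the permutation such that `f ∘ Tuple.sort f` is increasing.) -/
def std {k n : ℕ} (f : Fin k → Fin n) : Equiv.Perm (Fin k) := (Tuple.sort f)⁻¹

theorem std_lt_std {k n : ℕ} {f : Fin k → Fin n} (hf : Function.Injective f) {a b : Fin k} :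
    std f a < std f b ↔ f a < f b := by
  have hm : StrictMono (f ∘ Tuple.sort f) :=
    (Tuple.monotone_sort f).strictMono_of_injective (hf.comp (Tuple.sort f).injective)
  have h := hm.lt_iff_lt (a := std f a) (b := std f b)
  simpa [std] using h.symm

/-- The `j`-th block of `(π, μ)`, as a word. -/
def block {n : ℕ} (μ : Composition n) (π : Equiv.Perm (Fin n)) (j : Fin μ.length) :
    Fin (μ.blocksFun j) → Fin n :=
  fun a => π (μ.embedding j a)

theorem block_injective {n : ℕ} (μ : Composition n) (π : Equiv.Perm (Fin n))
    (j : Fin μ.length) : Function.Injective (block μ π j) :=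
  π.injective.comp (μ.embedding j).injective

/-- The set `I_μ` of `μ`-involutions: the standardization of each block is an involution. -/
def muInvolutions {n : ℕ} (μ : Composition n) : Set (Equiv.Perm (Fin n)) :=
  {π | ∀ j : Fin μ.length, (std (block μ π j))⁻¹ = std (block μ π j)}

/-- The block of `(π, μ)` that contains the value `v`. -/
def blockOf {n : ℕ} (μ : Composition n) (π : Equiv.Perm (Fin n)) (v : Fin n) : Fin μ.length :=
  μ.index (π⁻¹ v)

/-- The relative value `r_B(v)` of `v` in its block `B`. -/
def relValue {n : ℕ} (μ : Composition n) (π : Equiv.Perm (Fin n)) (v : Fin n) :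
    Fin (μ.blocksFun (blockOf μ π v)) :=
  std (block μ π (blockOf μ π v)) (μ.invEmbedding (π⁻¹ v))

/-- The position in `[n]` which corresponds to the position `r_B(v)` inside the block `B`
containing `v`. -/
def relPos {n : ℕ} (μ : Composition n) (π : Equiv.Perm (Fin n)) (v : Fin n) : Fin n :=
  μ.embedding (blockOf μ π v) (relValue μ π v)

theorem relPos_eq {n : ℕ} (μ : Composition n) (π : Equiv.Perm (Fin n)) (v : Fin n)
    (j : Fin μ.length) (a : Fin (μ.blocksFun j)) (h : block μ π j a = v) :
    relPos μ π v = μ.embedding j (std (block μ π j) a) := by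
  subst h
  have key : ∀ (p : Fin n), p = μ.embedding j a →
      μ.embedding (μ.index p) (std (block μ π (μ.index p)) (μ.invEmbedding p)) =
        μ.embedding j (std (block μ π j) a) := by
    intro p hp
    have hj : μ.index p = j := by rw [hp]; exact μ.index_embedding j a
    subst hj
    have : μ.invEmbedding p = a := by
      apply (μ.embedding (μ.index p)).injective
      rw [μ.embedding_comp_inv]; exact hp
    rw [this]
  exact key _ (by simp [block])

theorem relPos_lt {n : ℕ} (μ : Composition n) (π : Equiv.Perm (Fin n)) (i : Fin (n - 1))
    (h : blockOf μ π (lo i) = blockOf μ π (hi i)) : (relPos μ π (lo i) : ℕ) < n - 1 := by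
  obtain ⟨a, ha⟩ := μ.mem_range_embedding (π⁻¹ (lo i))
  have hab : ∃ (j : Fin μ.length) (a b : Fin (μ.blocksFun j)),
      block μ π j a = lo i ∧ block μ π j b = hi i := by
    change μ.index (π⁻¹ (lo i)) = μ.index (π⁻¹ (hi i)) at h
    obtain ⟨b', hb'⟩ : π⁻¹ (hi i) ∈ Set.range (μ.embedding (μ.index (π⁻¹ (lo i)))) := by
      rw [h]; exact μ.mem_range_embedding _
    exact ⟨_, a, b', by rw [block, ha]; simp, by rw [block, hb']; simp⟩
  obtain ⟨j, a, b, h1, h2⟩ := hab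
  have hlt : relPos μ π (lo i) < relPos μ π (hi i) := by
    rw [relPos_eq μ π _ j a h1, relPos_eq μ π _ j b h2]
    apply (μ.embedding j).strictMono
    rw [std_lt_std (block_injective μ π j), h1, h2]
    simp [lo, hi]
  have := (relPos μ π (hi i)).isLt
  have : (relPos μ π (lo i) : ℕ) < relPos μ π (hi i) := hlt
  omega

/-- The action `π ∘_μ s_i`: it is `s_i ∘ π` if `i, i+1` are in different blocks, and
`s_i ∘ π ∘ s_r` if they are in the same block, where `r` is the position inside that block
given by the relative value of `i`. -/
def muAct {n : ℕ} (μ : Composition n) (π : Equiv.Perm (Fin n)) (i : Fin (n - 1)) :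
    Equiv.Perm (Fin n) :=
  if h : blockOf μ π (lo i) = blockOf μ π (hi i) then
    heckeLeft i (heckeRight π ⟨relPos μ π (lo i), relPos_lt μ π i h⟩)
  else heckeLeft i π

/-- `e ∘_μ s_{a_1} ∘_μ ⋯ ∘_μ s_{a_p}`, performed from left to right. -/
def muWordAct {n : ℕ} (μ : Composition n) (a : List (Fin (n - 1))) : Equiv.Perm (Fin n) :=
  a.foldl (muAct μ) 1

/-- The set `R_μ(π)` of reduced `μ`-words of `π`: `μ`-words for `π` of minimal length. -/
def reducedMuWords {n : ℕ} (μ : Composition n) (π : Equiv.Perm (Fin n)) :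
    Set (List (Fin (n - 1))) :=
  {a | muWordAct μ a = π ∧ ∀ b : List (Fin (n - 1)), muWordAct μ b = π → a.length ≤ b.length}

/-- The set `A_μ(π)` of `μ`-atoms of `π`: the permutations whose reduced words make up
`R_μ(π)`. -/
def atoms {n : ℕ} (μ : Composition n) (π : Equiv.Perm (Fin n)) : Set (Equiv.Perm (Fin n)) :=
  {w | ∃ a ∈ reducedWords w, a ∈ reducedMuWords μ π}

/-- The set of inverse `μ`-atoms of `π`. -/
def inverseAtoms {n : ℕ} (μ : Composition n) (π : Equiv.Perm (Fin n)) :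
    Set (Equiv.Perm (Fin n)) :=
  {v | ∃ w ∈ atoms μ π, v = w⁻¹}

/-- `ν` refines `μ`: the partial sums of `μ` are among those of `ν`. -/
def Refines {n : ℕ} (ν μ : Composition n) : Prop := μ.boundaries ⊆ ν.boundaries

/-- The relation `τ ≤_A π`, for `τ` considered with the composition `ν` and `π` with `μ`. -/
def AtomLE {n : ℕ} (ν : Composition n) (τ : Equiv.Perm (Fin n)) (μ : Composition n)
    (π : Equiv.Perm (Fin n)) : Prop :=
  Refines ν μ ∧ atoms ν τ ⊆ atoms μ π

/-! ### Schubert polynomials -/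

/-- The action of the transposition `(a b)` on polynomials by permuting the variables. -/
def varSwap {n : ℕ} (a b : Fin n) : MvPolynomial (Fin n) ℤ →ₐ[ℤ] MvPolynomial (Fin n) ℤ :=
  MvPolynomial.rename (Equiv.swap a b)

theorem dvd_sub_varSwap {n : ℕ} (a b : Fin n) (f : MvPolynomial (Fin n) ℤ) :
    (MvPolynomial.X a - MvPolynomial.X b : MvPolynomial (Fin n) ℤ) ∣ f - varSwap a b f := by
  rw [← Ideal.mem_span_singleton, ← Ideal.Quotient.eq]
  set I : Ideal (MvPolynomial (Fin n) ℤ) :=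
    Ideal.span {MvPolynomial.X a - MvPolynomial.X b} with hI
  have hab : Ideal.Quotient.mk I (MvPolynomial.X a) = Ideal.Quotient.mk I (MvPolynomial.X b) := by
    rw [Ideal.Quotient.eq]; exact Ideal.mem_span_singleton_self _
  have key : Ideal.Quotient.mkₐ ℤ I = (Ideal.Quotient.mkₐ ℤ I).comp (varSwap a b) := by
    apply MvPolynomial.algHom_ext
    intro k
    simp only [AlgHom.comp_apply, varSwap, MvPolynomial.rename_X, Ideal.Quotient.mkₐ_eq_mk]
    rcases eq_or_ne k a with rfl | hka
    · rw [Equiv.swap_apply_left, hab]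
    · rcases eq_or_ne k b with rfl | hkb
      · rw [Equiv.swap_apply_right, hab]
      · rw [Equiv.swap_apply_of_ne_of_ne hka hkb]
  exact congrArg (fun φ => φ f) key

/-- The quotient `(f - (a b) f) / (x_a - x_b)`. -/
def divDiff {n : ℕ} (a b : Fin n) (f : MvPolynomial (Fin n) ℤ) : MvPolynomial (Fin n) ℤ :=
  Classical.choose (dvd_sub_varSwap a b f)

theorem divDiff_spec {n : ℕ} (a b : Fin n) (f : MvPolynomial (Fin n) ℤ) :
    (MvPolynomial.X a - MvPolynomial.X b) * divDiff a b f = f - varSwap a b f :=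
  (Classical.choose_spec (dvd_sub_varSwap a b f)).symm

/-- The divided difference operator `∂_i`. -/
def partialOp {n : ℕ} (i : Fin (n - 1)) (f : MvPolynomial (Fin n) ℤ) :
    MvPolynomial (Fin n) ℤ :=
  divDiff (lo i) (hi i) f

theorem lo_ne_hi {n : ℕ} (i : Fin (n - 1)) : lo i ≠ hi i := by
  simp [lo, hi]

theorem sum_mul_simple_lt {n : ℕ} (w : Equiv.Perm (Fin n)) (i : Fin (n - 1))
    (h : w (lo i) < w (hi i)) :
    ∑ k : Fin n, (k : ℕ) * ((w * simple i) k : ℕ) < ∑ k : Fin n, (k : ℕ) * (w k : ℕ) := by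
  have split : ∀ g : Fin n → ℕ, ∑ k, g k =
      g (lo i) + g (hi i) + ∑ k ∈ (Finset.univ.erase (lo i)).erase (hi i), g k := by
    intro g
    rw [← Finset.add_sum_erase _ g (Finset.mem_univ (lo i)),
      ← Finset.add_sum_erase _ g (Finset.mem_erase.2 ⟨(lo_ne_hi i).symm, Finset.mem_univ (hi i)⟩),
      add_assoc]
  rw [split, split]
  have hrest : ∑ k ∈ (Finset.univ.erase (lo i)).erase (hi i), (k : ℕ) * ((w * simple i) k : ℕ) =
      ∑ k ∈ (Finset.univ.erase (lo i)).erase (hi i), (k : ℕ) * (w k : ℕ) := by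
    apply Finset.sum_congr rfl
    intro k hk
    simp only [Finset.mem_erase, Finset.mem_univ, and_true] at hk
    rw [Equiv.Perm.mul_apply, simple, Equiv.swap_apply_of_ne_of_ne hk.2 hk.1]
  rw [hrest]
  have h' : (w (lo i) : ℕ) < w (hi i) := h
  simp only [Equiv.Perm.mul_apply, simple, Equiv.swap_apply_left, Equiv.swap_apply_right]
  have e1 : ((lo i : Fin n) : ℕ) = i := rfl
  have e2 : ((hi i : Fin n) : ℕ) = i + 1 := rfl
  rw [e1, e2]
  nlinarith

open Classical in
/-- The Schubert polynomial of `w`: it is `∂_i 𝔖_{w s_i}` if `w(i) < w(i+1)`, and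
`x_1^{n-1} x_2^{n-2} ⋯ x_{n-1}` if there is no such `i`, i.e. if `w` is the reverse permutation.
See `schubert_of_lt` and `schubert_rev` below for the defining recursion, with an
arbitrary `i`. -/
def schubert {n : ℕ} (w : Equiv.Perm (Fin n)) : MvPolynomial (Fin n) ℤ :=
  if h : ∃ i : Fin (n - 1), w (lo i) < w (hi i) then
    partialOp (Classical.choose h) (schubert (w * simple (Classical.choose h)))
  else ∏ k : Fin n, MvPolynomial.X k ^ (n - 1 - (k : ℕ))
termination_by ∑ k : Fin n, (k : ℕ) * (w k : ℕ)
decreasing_by exact sum_mul_simple_lt w _ (Classical.choose_spec h)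

theorem schubert_rev {n : ℕ} :
    schubert (Fin.revPerm : Equiv.Perm (Fin n)) =
      ∏ k : Fin n, MvPolynomial.X k ^ (n - 1 - (k : ℕ)) := by
  rw [schubert, dif_neg]
  rintro ⟨i, hi'⟩
  simp [lo, hi, Fin.lt_def] at hi'
  omega

theorem X_sub_X_ne_zero {n : ℕ} {a b : Fin n} (h : a ≠ b) :
    (MvPolynomial.X a - MvPolynomial.X b : MvPolynomial (Fin n) ℤ) ≠ 0 :=
  sub_ne_zero.2 fun e => h (MvPolynomial.X_injective e)

theorem varSwap_varSwap {n : ℕ} (a b c d : Fin n) (f : MvPolynomial (Fin n) ℤ) :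
    varSwap a b (varSwap c d f) =
      MvPolynomial.rename (Equiv.swap a b * Equiv.swap c d : Equiv.Perm (Fin n)) f := by
  simp only [varSwap, MvPolynomial.rename_rename]; rfl

theorem varSwap_self_inv {n : ℕ} (a b : Fin n) (f : MvPolynomial (Fin n) ℤ) :
    varSwap a b (varSwap a b f) = f := by
  rw [varSwap_varSwap, Equiv.swap_mul_self]
  exact MvPolynomial.rename_id_apply f

theorem divDiff_comm {n : ℕ} {a b c d : Fin n} (hab : a ≠ b) (hcd : c ≠ d) (hac : a ≠ c)
    (had : a ≠ d) (hbc : b ≠ c) (hbd : b ≠ d) (f : MvPolynomial (Fin n) ℤ) :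
    divDiff a b (divDiff c d f) = divDiff c d (divDiff a b f) := by
  apply mul_left_cancel₀ (X_sub_X_ne_zero hab)
  apply mul_left_cancel₀ (X_sub_X_ne_zero hcd)
  have h1 := divDiff_spec a b (divDiff c d f)
  have h2 := divDiff_spec c d f
  have h3 := congrArg (varSwap a b) h2
  have k1 := divDiff_spec c d (divDiff a b f)
  have k2 := divDiff_spec a b f
  have k3 := congrArg (varSwap c d) k2
  have hc : varSwap a b (varSwap c d f) = varSwap c d (varSwap a b f) := by
    rw [varSwap_varSwap, varSwap_varSwap, (Equiv.Perm.Disjoint.commute ?_).eq]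
    rw [Equiv.Perm.disjoint_iff_disjoint_support, Equiv.Perm.support_swap hab,
      Equiv.Perm.support_swap hcd]
    simp [hac.symm, had.symm, hbc.symm, hbd.symm]
  have e1 : varSwap a b (MvPolynomial.X c) = MvPolynomial.X c := by
    simp [varSwap, Equiv.swap_apply_of_ne_of_ne hac.symm hbc.symm]
  have e2 : varSwap a b (MvPolynomial.X d) = MvPolynomial.X d := by
    simp [varSwap, Equiv.swap_apply_of_ne_of_ne had.symm hbd.symm]
  have e3 : varSwap c d (MvPolynomial.X a) = MvPolynomial.X a := by
    simp [varSwap, Equiv.swap_apply_of_ne_of_ne hac had]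
  have e4 : varSwap c d (MvPolynomial.X b) = MvPolynomial.X b := by
    simp [varSwap, Equiv.swap_apply_of_ne_of_ne hbc hbd]
  rw [map_mul, map_sub, map_sub, e1, e2, hc] at h3
  rw [map_mul, map_sub, map_sub, e3, e4] at k3
  linear_combination (MvPolynomial.X c - MvPolynomial.X d) * h1 + h2 - h3
    - (MvPolynomial.X a - MvPolynomial.X b) * k1 - k2 + k3

theorem divDiff_braid_aux {n : ℕ} {a b c : Fin n} (hab : a ≠ b) (hbc : b ≠ c) (hac : a ≠ c)
    (f : MvPolynomial (Fin n) ℤ) :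
    (MvPolynomial.X a - MvPolynomial.X b) * (MvPolynomial.X b - MvPolynomial.X c) *
        (MvPolynomial.X a - MvPolynomial.X c) * divDiff a b (divDiff b c (divDiff a b f)) =
      f - varSwap a b f - varSwap b c f + varSwap b c (varSwap a b f) +
        varSwap a b (varSwap b c f) - varSwap a b (varSwap b c (varSwap a b f)) := by
  set g := divDiff a b f with hg
  set h := divDiff b c g with hh
  have g1 := divDiff_spec a b f
  have h1 := divDiff_spec b c g
  have k1 := divDiff_spec a b h
  rw [← hg] at g1
  rw [← hh] at h1
  have xa : varSwap a b (MvPolynomial.X a) = MvPolynomial.X b := by simp [varSwap]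
  have xb : varSwap a b (MvPolynomial.X b) = MvPolynomial.X a := by simp [varSwap]
  have xc : varSwap a b (MvPolynomial.X c) = MvPolynomial.X c := by
    simp [varSwap, Equiv.swap_apply_of_ne_of_ne hac.symm hbc.symm]
  have ya : varSwap b c (MvPolynomial.X a) = MvPolynomial.X a := by
    simp [varSwap, Equiv.swap_apply_of_ne_of_ne hab hac]
  have yb : varSwap b c (MvPolynomial.X b) = MvPolynomial.X c := by simp [varSwap]
  have h2 := congrArg (varSwap a b) h1
  have g2 := congrArg (varSwap a b) g1
  have g3 := congrArg (varSwap b c) g1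
  have g4 := congrArg (varSwap a b) g3
  simp only [map_mul, map_sub, xa, xb, xc, ya, yb, varSwap_self_inv] at h2 g2 g3 g4
  have gs : varSwap a b g = g := by
    apply mul_left_cancel₀ (X_sub_X_ne_zero hab)
    linear_combination -g2 - g1
  rw [gs] at h2
  linear_combination (MvPolynomial.X b - MvPolynomial.X c) *
      (MvPolynomial.X a - MvPolynomial.X c) * k1
    + (MvPolynomial.X a - MvPolynomial.X c) * h1
    - (MvPolynomial.X b - MvPolynomial.X c) * h2 + g1 - g3 + g4

theorem varSwap_symm {n : ℕ} (a b : Fin n) (f : MvPolynomial (Fin n) ℤ) :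
    varSwap a b f = varSwap b a f := by
  rw [varSwap, Equiv.swap_comm]; rfl

theorem divDiff_symm {n : ℕ} {a b : Fin n} (hab : a ≠ b) (f : MvPolynomial (Fin n) ℤ) :
    divDiff b a f = -divDiff a b f := by
  apply mul_left_cancel₀ (X_sub_X_ne_zero hab)
  have h1 := divDiff_spec a b f
  have h2 := divDiff_spec b a f
  rw [← varSwap_symm a b] at h2
  linear_combination h1 - h2

theorem divDiff_neg {n : ℕ} {a b : Fin n} (hab : a ≠ b) (f : MvPolynomial (Fin n) ℤ) :
    divDiff a b (-f) = -divDiff a b f := by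
  apply mul_left_cancel₀ (X_sub_X_ne_zero hab)
  have h1 := divDiff_spec a b f
  have h2 := divDiff_spec a b (-f)
  rw [map_neg] at h2
  linear_combination h1 + h2

theorem swap_braid {n : ℕ} {a b c : Fin n} (hab : a ≠ b) (hbc : b ≠ c) (hac : a ≠ c) :
    Equiv.swap a b * Equiv.swap b c * Equiv.swap a b =
      Equiv.swap b c * Equiv.swap a b * Equiv.swap b c := by
  rw [Equiv.swap_mul_swap_mul_swap hab hac, Equiv.swap_comm a b, Equiv.swap_comm b c,
    Equiv.swap_mul_swap_mul_swap hbc.symm hac.symm, Equiv.swap_comm]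

theorem divDiff_braid {n : ℕ} {a b c : Fin n} (hab : a ≠ b) (hbc : b ≠ c) (hac : a ≠ c)
    (f : MvPolynomial (Fin n) ℤ) :
    divDiff a b (divDiff b c (divDiff a b f)) = divDiff b c (divDiff a b (divDiff b c f)) := by
  have h1 := divDiff_braid_aux hab hbc hac f
  have h2 := divDiff_braid_aux hbc.symm hab.symm hac.symm f
  have e : divDiff c b (divDiff b a (divDiff c b f)) =
      -divDiff b c (divDiff a b (divDiff b c f)) := by
    rw [divDiff_symm hbc, divDiff_symm hab, divDiff_symm hbc, divDiff_neg hab, neg_neg]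
  have hσ : varSwap a b (varSwap b c (varSwap a b f)) =
      varSwap b c (varSwap a b (varSwap b c f)) := by
    rw [varSwap_varSwap b c, varSwap_varSwap a b]
    simp only [varSwap, MvPolynomial.rename_rename]
    have hp := swap_braid hab hbc hac
    simp only [mul_assoc] at hp
    have hf := congrArg (fun p : Equiv.Perm (Fin n) => MvPolynomial.rename (R := ℤ) p f) hp
    exact hf
  rw [e, varSwap_symm c b, varSwap_symm c b, varSwap_symm c b, varSwap_symm b a,
    varSwap_symm b a] at h2
  apply mul_left_cancel₀ (X_sub_X_ne_zero hab)
  apply mul_left_cancel₀ (X_sub_X_ne_zero hbc)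
  apply mul_left_cancel₀ (X_sub_X_ne_zero hac)
  rw [hσ] at h1
  linear_combination h1 - h2

theorem schubert_of_lt {n : ℕ} (w : Equiv.Perm (Fin n)) (i : Fin (n - 1))
    (h : w (lo i) < w (hi i)) : schubert w = partialOp i (schubert (w * simple i)) := by
  induction hN : ∑ k : Fin n, (k : ℕ) * (w k : ℕ) using Nat.strong_induction_on
    generalizing w i with
  | _ N ih =>
  subst hN
  -- two ascents give the same polynomial
  have main : ∀ i j : Fin (n - 1), (i : ℕ) < j → w (lo i) < w (hi i) → w (lo j) < w (hi j) →
      partialOp i (schubert (w * simple i)) = partialOp j (schubert (w * simple j)) := by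
    intro i j hij hwi hwj
    have hmi := sum_mul_simple_lt w i hwi
    have hmj := sum_mul_simple_lt w j hwj
    have lolo : lo i ≠ lo j := by simp only [lo, ne_eq, Fin.mk.injEq]; omega
    have lohi : lo i ≠ hi j := by simp only [lo, hi, ne_eq, Fin.mk.injEq]; omega
    have hihi : hi i ≠ hi j := by simp only [hi, ne_eq, Fin.mk.injEq]; omega
    by_cases hadj : (j : ℕ) = i + 1
    · have hl : lo j = hi i := by simp only [lo, hi, Fin.mk.injEq]; omega
      have a1 : (w * simple i) (lo i) = w (hi i) := by simp [simple]
      have a2 : (w * simple i) (hi i) = w (lo i) := by simp [simple]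
      have a3 : (w * simple i) (hi j) = w (hi j) := by
        simp [simple, Equiv.swap_apply_of_ne_of_ne lohi.symm hihi.symm]
      have b1 : (w * simple j) (lo i) = w (lo i) := by
        simp [simple, Equiv.swap_apply_of_ne_of_ne lolo lohi]
      have b2 : (w * simple j) (hi i) = w (hi j) := by simp [simple, ← hl]
      have b3 : (w * simple j) (hi j) = w (hi i) := by simp [simple, ← hl]
      rw [hl] at hwj
      have c1 : (w * simple i) (lo j) < (w * simple i) (hi j) := by
        rw [hl, a2, a3]; exact hwi.trans hwj
      have d1 : (w * simple j) (lo i) < (w * simple j) (hi i) := by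
        rw [b1, b2]; exact hwi.trans hwj
      have c2 : (w * simple i * simple j) (lo i) < (w * simple i * simple j) (hi i) := by
        have e1 : (w * simple i * simple j) (lo i) = w (hi i) := by
          rw [Equiv.Perm.mul_apply _ (simple j)]
          nth_rewrite 2 [simple]
          rw [Equiv.swap_apply_of_ne_of_ne lolo lohi, a1]
        have e2 : (w * simple i * simple j) (hi i) = w (hi j) := by
          rw [Equiv.Perm.mul_apply _ (simple j), ← hl]
          simp only [simple, Equiv.swap_apply_left]
          exact a3
        rw [e1, e2]; exact hwj
      have d2 : (w * simple j * simple i) (lo j) < (w * simple j * simple i) (hi j) := by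
        have e1 : (w * simple j * simple i) (lo j) = w (lo i) := by
          rw [Equiv.Perm.mul_apply _ (simple i), hl]
          simp only [simple, Equiv.swap_apply_right]
          exact b1
        have e2 : (w * simple j * simple i) (hi j) = w (hi i) := by
          rw [Equiv.Perm.mul_apply _ (simple i)]
          nth_rewrite 2 [simple]
          rw [Equiv.swap_apply_of_ne_of_ne lohi.symm hihi.symm, b3]
        rw [e1, e2]; exact hwi
      rw [ih _ hmi _ j c1 rfl, ih _ hmj _ i d1 rfl,
        ih _ ((sum_mul_simple_lt _ _ c1).trans hmi) _ i c2 rfl,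
        ih _ ((sum_mul_simple_lt _ _ d1).trans hmj) _ j d2 rfl]
      have hp : w * simple i * simple j * simple i = w * simple j * simple i * simple j := by
        have hne : lo i ≠ hi i := lo_ne_hi i
        simp only [mul_assoc]
        congr 1
        simp only [← mul_assoc, simple, hl]
        exact swap_braid (lo_ne_hi i) hihi lohi
      rw [hp]
      simp only [partialOp, hl]
      exact divDiff_braid (lo_ne_hi i) hihi lohi _
    · have hilo : hi i ≠ lo j := by simp only [lo, hi, ne_eq, Fin.mk.injEq]; omega
      have c1 : (w * simple i) (lo j) < (w * simple i) (hi j) := by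
        simpa [simple, Equiv.swap_apply_of_ne_of_ne lolo.symm hilo.symm,
          Equiv.swap_apply_of_ne_of_ne lohi.symm hihi.symm] using hwj
      have d1 : (w * simple j) (lo i) < (w * simple j) (hi i) := by
        simpa [simple, Equiv.swap_apply_of_ne_of_ne lolo lohi,
          Equiv.swap_apply_of_ne_of_ne hilo hihi] using hwi
      have hc : simple i * simple j = simple j * simple i := by
        apply Equiv.Perm.Disjoint.commute
        rw [Equiv.Perm.disjoint_iff_disjoint_support, simple, simple,
          Equiv.Perm.support_swap (lo_ne_hi i), Equiv.Perm.support_swap (lo_ne_hi j)]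
        simp [lolo.symm, lohi.symm, hihi.symm, hilo.symm]
      rw [ih _ hmi _ j c1 rfl, ih _ hmj _ i d1 rfl, mul_assoc, hc, ← mul_assoc]
      exact divDiff_comm (lo_ne_hi i) (lo_ne_hi j) lolo lohi hilo hihi _
  have hex : ∃ i : Fin (n - 1), w (lo i) < w (hi i) := ⟨i, h⟩
  rw [schubert, dif_pos hex]
  have h0 := Classical.choose_spec hex
  rcases lt_trichotomy ((Classical.choose hex : Fin (n - 1)) : ℕ) i with hlt | heq | hgt
  · exact main _ _ hlt h0 h
  · rw [Fin.ext heq]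
  · exact (main _ _ hgt h h0).symm

/-- The `μ`-involution Schubert polynomial of `π`: the sum of the Schubert polynomials of the
`μ`-atoms of `π`. -/
def muSchubert {n : ℕ} (μ : Composition n) (π : Equiv.Perm (Fin n)) :
    MvPolynomial (Fin n) ℤ :=
  ∑ w ∈ (Set.toFinite (atoms μ π)).toFinset, schubert w

end MuInv

end

/-!
The one-line notation of a permutation `π`, cut into blocks according to `μ`, amounts to a
factorization `π = u σ`, where `u` is increasing on the blocks and `σ` lies in the Young subgroup
of `μ` and acts on each block by its standardization (`factorization_unique`, `blockStd_mul`). In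
these terms the letter `s_i` acts by 0-Hecke conjugation on `σ` if `s_i u = u s_j` with `s_j` in the
Young subgroup, and by the left 0-Hecke operator on `u` otherwise. It follows that if a word has
0-Hecke product `u v` (the letters acting from the left), then its `μ`-action on the identity gives
`u (v ∘ v⁻¹)`; see `exists_factorization`. Here `v ∘ v⁻¹` makes sense because left and right 0-Hecke
operators commute (`heckeLeft_heckeRight`, `conjEval_congr`).

Two facts follow. First, the action of a word depends only on its 0-Hecke product
(`muWordAct_congr`), so that all reduced words of a permutation act alike, and no permutation is an
atom of two elements. Secondly, if `ν` refines `μ`, the `ν`-action of a word determines its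
`μ`-action (`muWordAct_eq_of_refines`): with `u (v ∘ v⁻¹)` the result of the `ν`-action, the element
`v` also lies in the Young subgroup of `μ`, so the `μ`-action gives what a word for `u` makes of
`v ∘ v⁻¹`. Hence if `a` is a reduced word of a `μ`-atom `w` of `π`, and `τ` is the result of the
`ν`-action of `a`, then a shorter `ν`-word for `τ` would be a shorter `μ`-word for `π`; so `w` is a
`ν`-atom of `τ`, and in the same way every `ν`-atom of `τ` is a `μ`-atom of `π`
(`exists_mem_atoms_of_refines`). The atoms of `π` are therefore the disjoint union of the atoms of
the elements below `π`, which gives both parts of the theorem.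
-/

namespace MuInv

variable {n : ℕ}

/-! ### 0-Hecke operators on permutations -/

theorem coe_lo (i : Fin (n - 1)) : ((lo i : Fin n) : ℕ) = i := rfl

theorem coe_hi (i : Fin (n - 1)) : ((hi i : Fin n) : ℕ) = i + 1 := rfl

theorem simple_lo (i : Fin (n - 1)) : simple i (lo i) = hi i := Equiv.swap_apply_left _ _

theorem simple_hi (i : Fin (n - 1)) : simple i (hi i) = lo i := Equiv.swap_apply_right _ _

theorem apply_inv_apply (u : Equiv.Perm (Fin n)) (x : Fin n) : u (u⁻¹ x) = x := by simp

theorem simple_inv (i : Fin (n - 1)) : (simple i)⁻¹ = simple i := Equiv.swap_inv _ _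

theorem simple_mul_self (i : Fin (n - 1)) : simple i * simple i = 1 := Equiv.swap_mul_self _ _

theorem lo_lt_hi (i : Fin (n - 1)) : lo i < hi i := by
  simp [Fin.lt_def, coe_lo, coe_hi]

theorem coe_simple (i : Fin (n - 1)) (x : Fin n) :
    (simple i x : ℕ) = if (x : ℕ) = i then (i : ℕ) + 1 else if (x : ℕ) = i + 1 then i else x := by
  simp only [simple, Equiv.swap_apply_def, Fin.ext_iff, coe_lo, coe_hi]
  split_ifs <;> simp [coe_lo, coe_hi]

/-- A simple transposition only changes the relative order of the two symbols it exchanges. -/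
theorem simple_lt_simple {i : Fin (n - 1)} {x y : Fin n} (h₁ : ¬(x = lo i ∧ y = hi i))
    (h₂ : ¬(x = hi i ∧ y = lo i)) : simple i x < simple i y ↔ x < y := by
  simp only [Fin.lt_def, Fin.ext_iff, coe_simple, coe_lo, coe_hi] at *
  split_ifs <;> omega

/-- If `u` maps the adjacent symbols of `s_j` to those of `s_i`, then `s_i u = u s_j`. -/
theorem simple_mul_eq_mul_simple {u : Equiv.Perm (Fin n)} {i j : Fin (n - 1)}
    (hlo : u (lo j) = lo i) (hhi : u (hi j) = hi i) : simple i * u = u * simple j := by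
  rw [simple, simple, ← hlo, ← hhi, Equiv.mul_swap_eq_swap_mul]

theorem inv_heckeLeft (i : Fin (n - 1)) (w : Equiv.Perm (Fin n)) :
    (heckeLeft i w)⁻¹ = heckeRight w⁻¹ i := by
  unfold heckeLeft heckeRight
  split_ifs <;> simp [simple_inv]

theorem inv_heckeRight (w : Equiv.Perm (Fin n)) (i : Fin (n - 1)) :
    (heckeRight w i)⁻¹ = heckeLeft i w⁻¹ := by
  rw [← inv_inv (heckeLeft i w⁻¹), inv_heckeLeft, inv_inv]

/-- Left and right 0-Hecke operators commute. The only case in which they interact is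
`s_i w = w s_j`. -/
theorem heckeLeft_heckeRight (i j : Fin (n - 1)) (w : Equiv.Perm (Fin n)) :
    heckeLeft i (heckeRight w j) = heckeRight (heckeLeft i w) j := by
  have hij := lo_lt_hi i
  have hjj := lo_lt_hi j
  by_cases h₁ : w (lo j) = lo i ∧ w (hi j) = hi i
  · obtain ⟨hl, hh⟩ := h₁
    have hl' : w⁻¹ (lo i) = lo j := by rw [← hl]; simp
    have hh' : w⁻¹ (hi i) = hi j := by rw [← hh]; simp
    have hs := simple_mul_eq_mul_simple hl hh
    have e₁ : heckeRight w j = w * simple j := by rw [heckeRight, if_pos (by rwa [hl, hh])]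
    have e₂ : heckeLeft i w = simple i * w := by rw [heckeLeft, if_pos (by rwa [hl', hh'])]
    rw [e₁, e₂, heckeLeft, heckeRight, if_neg, if_neg, hs]
    · simp [hl, hh, simple_lo, simple_hi, hij.le]
    · simp only [mul_inv_rev, simple_inv, Equiv.Perm.mul_apply, hl', hh', simple_lo, simple_hi]
      exact hjj.not_gt
  · by_cases h₂ : w (lo j) = hi i ∧ w (hi j) = lo i
    · obtain ⟨hl, hh⟩ := h₂
      have hl' : w⁻¹ (hi i) = lo j := by rw [← hl]; simp
      have hh' : w⁻¹ (lo i) = hi j := by rw [← hh]; simp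
      have e₁ : heckeRight w j = w := by
        rw [heckeRight, if_neg (by rw [hl, hh]; exact hij.not_gt)]
      have e₂ : heckeLeft i w = w := by
        rw [heckeLeft, if_neg (by rw [hl', hh']; exact hjj.not_gt)]
      rw [e₁, e₂, e₁]
    · have k₁ : simple i (w (lo j)) < simple i (w (hi j)) ↔ w (lo j) < w (hi j) :=
        simple_lt_simple h₁ h₂
      have k₂ : simple j (w⁻¹ (lo i)) < simple j (w⁻¹ (hi i)) ↔ w⁻¹ (lo i) < w⁻¹ (hi i) := by
        apply simple_lt_simple
        · rintro ⟨a, b⟩; exact h₁ ⟨by rw [← a]; simp, by rw [← b]; simp⟩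
        · rintro ⟨a, b⟩; exact h₂ ⟨by rw [← b]; simp, by rw [← a]; simp⟩
      unfold heckeLeft heckeRight
      by_cases c₁ : w (lo j) < w (hi j) <;> by_cases c₂ : w⁻¹ (lo i) < w⁻¹ (hi i) <;>
        simp only [c₁, c₂, if_true, if_false, mul_inv_rev, simple_inv, Equiv.Perm.mul_apply, k₁,
          k₂, mul_assoc]

/-- The word `a = (a_1, …, a_p)` acting through left 0-Hecke operators:
`s_{a_p} ∘ ⋯ ∘ s_{a_1} ∘ x`. -/
def leftEval (a : List (Fin (n - 1))) (x : Equiv.Perm (Fin n)) : Equiv.Perm (Fin n) :=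
  a.foldl (fun y i => heckeLeft i y) x

/-- The word `a = (a_1, …, a_p)` acting through right 0-Hecke operators:
`x ∘ s_{a_1} ∘ ⋯ ∘ s_{a_p}`. -/
def rightEval (a : List (Fin (n - 1))) (x : Equiv.Perm (Fin n)) : Equiv.Perm (Fin n) :=
  a.foldl heckeRight x

/-- The 0-Hecke conjugate `s_{a_p} ∘ ⋯ ∘ s_{a_1} ∘ 1 ∘ s_{a_1} ∘ ⋯ ∘ s_{a_p}` of the identity. -/
def conjEval (a : List (Fin (n - 1))) : Equiv.Perm (Fin n) :=
  a.foldl (fun y i => heckeLeft i (heckeRight y i)) 1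

theorem leftEval_append (a b : List (Fin (n - 1))) (x : Equiv.Perm (Fin n)) :
    leftEval (a ++ b) x = leftEval b (leftEval a x) :=
  List.foldl_append

theorem leftEval_concat (a : List (Fin (n - 1))) (i : Fin (n - 1)) (x : Equiv.Perm (Fin n)) :
    leftEval (a ++ [i]) x = heckeLeft i (leftEval a x) := by
  simp [leftEval]

theorem rightEval_concat (a : List (Fin (n - 1))) (i : Fin (n - 1)) (x : Equiv.Perm (Fin n)) :
    rightEval (a ++ [i]) x = heckeRight (rightEval a x) i := by
  simp [rightEval]

theorem conjEval_concat (a : List (Fin (n - 1))) (i : Fin (n - 1)) :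
    conjEval (a ++ [i]) = heckeLeft i (heckeRight (conjEval a) i) := by
  simp [conjEval]

theorem leftEval_heckeRight (a : List (Fin (n - 1))) (i : Fin (n - 1))
    (x : Equiv.Perm (Fin n)) :
    leftEval a (heckeRight x i) = heckeRight (leftEval a x) i := by
  induction a using List.reverseRecOn with
  | nil => rfl
  | append_singleton a j ih => rw [leftEval_concat, leftEval_concat, ih, heckeLeft_heckeRight]

theorem leftEval_rightEval (a b : List (Fin (n - 1))) (x : Equiv.Perm (Fin n)) :
    leftEval a (rightEval b x) = rightEval b (leftEval a x) := by
  induction b using List.reverseRecOn with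
  | nil => rfl
  | append_singleton b j ih => rw [rightEval_concat, rightEval_concat, leftEval_heckeRight, ih]

theorem inv_leftEval (a : List (Fin (n - 1))) (x : Equiv.Perm (Fin n)) :
    (leftEval a x)⁻¹ = rightEval a x⁻¹ := by
  induction a using List.reverseRecOn with
  | nil => rfl
  | append_singleton a j ih => rw [leftEval_concat, rightEval_concat, inv_heckeLeft, ih]

theorem conjEval_eq (a : List (Fin (n - 1))) : conjEval a = leftEval a (rightEval a 1) := by
  induction a using List.reverseRecOn with
  | nil => rfl
  | append_singleton a j ih =>
    rw [conjEval_concat, ih, leftEval_concat, rightEval_concat, leftEval_heckeRight]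

/-- The 0-Hecke conjugate of the identity by a word only depends on the 0-Hecke product of the
word: writing `v` for that product, it is `v ∘ v⁻¹`. -/
theorem conjEval_congr {a b : List (Fin (n - 1))} (h : leftEval a 1 = leftEval b 1) :
    conjEval a = conjEval b := by
  have hr : rightEval a 1 = rightEval b 1 := by
    simpa [inv_leftEval] using congrArg (·⁻¹) h
  rw [conjEval_eq, conjEval_eq, hr, leftEval_rightEval, h, ← leftEval_rightEval]

theorem conjEval_inv (a : List (Fin (n - 1))) : (conjEval a)⁻¹ = conjEval a := by
  induction a using List.reverseRecOn with
  | nil => simp [conjEval]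
  | append_singleton a j ih =>
    rw [conjEval_concat, inv_heckeLeft, inv_heckeRight, ih, heckeLeft_heckeRight]

/-! ### Reduced words -/

theorem wordProd_concat (a : List (Fin (n - 1))) (i : Fin (n - 1)) :
    wordProd (a ++ [i]) = wordProd a * simple i := by
  simp [wordProd]

/-- The deletion property: if `w(i) > w(i+1)`, then deleting a suitable letter of a word for `w`
gives a word for `w s_i`. -/
theorem exists_word_mul_simple (a : List (Fin (n - 1))) (i : Fin (n - 1))
    (h : wordProd a (hi i) < wordProd a (lo i)) :
    ∃ b : List (Fin (n - 1)), b.length + 1 = a.length ∧ wordProd b = wordProd a * simple i := by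
  induction a with
  | nil => exact absurd h (by simpa [wordProd] using (lo_lt_hi i).le)
  | cons j a ih =>
    have e : wordProd (j :: a) = simple j * wordProd a := by simp [wordProd]
    rw [e] at h ⊢
    by_cases hlt : wordProd a (hi i) < wordProd a (lo i)
    · obtain ⟨b, hb, hw⟩ := ih hlt
      exact ⟨j :: b, by simp [hb], by rw [mul_assoc, ← hw]; simp [wordProd]⟩
    · -- `s_j` reverses the order of the two values, so they are the symbols exchanged by `s_j`
      have hlh : wordProd a (lo i) = lo j ∧ wordProd a (hi i) = hi j := by
        by_contra hne
        by_cases hne' : wordProd a (lo i) = hi j ∧ wordProd a (hi i) = lo j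
        · rw [hne'.1, hne'.2] at hlt; exact hlt (lo_lt_hi j)
        · exact hlt ((simple_lt_simple (fun c => hne' c.symm) (fun c => hne c.symm)).1 h)
      refine ⟨a, by simp, ?_⟩
      rw [simple_mul_eq_mul_simple hlh.1 hlh.2, mul_assoc, simple_mul_self, mul_one]

/-- For a reduced word the 0-Hecke product is the product in the symmetric group. The inverse
comes from letting the letters act from the left. -/
theorem leftEval_one_of_mem_reducedWords {a : List (Fin (n - 1))} {w : Equiv.Perm (Fin n)}
    (ha : a ∈ reducedWords w) : leftEval a 1 = w⁻¹ := by
  induction a using List.reverseRecOn generalizing w with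
  | nil => rw [← ha.1]; simp [leftEval, wordProd]
  | append_singleton a i ih =>
    obtain ⟨rfl, hmin⟩ := ha
    rw [wordProd_concat] at hmin ⊢
    have hred : a ∈ reducedWords (wordProd a) := by
      refine ⟨rfl, fun b hb => ?_⟩
      simpa using hmin (b ++ [i]) (by rw [wordProd_concat, hb])
    rw [leftEval_concat, ih hred, heckeLeft, if_pos]
    · simp [simple_inv]
    · rw [inv_inv]
      by_contra hlt
      have hne : wordProd a (lo i) ≠ wordProd a (hi i) := fun h =>
        lo_ne_hi i ((wordProd a).injective h)
      obtain ⟨b, hb, hw⟩ :=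
        exists_word_mul_simple a i (lt_of_le_of_ne (not_lt.1 hlt) hne.symm)
      have := hmin b hw
      simp at this
      omega

/-! ### Permutations and blocks of a composition -/

/-- `u` is increasing on each block of `μ`, i.e. it is the minimal representative of its coset
of the Young subgroup of `μ`. -/
def IncreasingOnBlocks (μ : Composition n) (u : Equiv.Perm (Fin n)) : Prop :=
  ∀ p q, p < q → μ.index p = μ.index q → u p < u q

/-- `σ` maps each block of `μ` to itself, i.e. it lies in the Young subgroup of `μ`. -/
def PreservesBlocks (μ : Composition n) (σ : Equiv.Perm (Fin n)) : Prop :=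
  ∀ p, μ.index (σ p) = μ.index p

variable {μ ν : Composition n} {u v σ τ : Equiv.Perm (Fin n)}

theorem index_mono (μ : Composition n) : Monotone μ.index := by
  intro p q hpq
  by_contra h
  have h₁ : (μ.index q : ℕ) + 1 ≤ μ.index p := Fin.lt_def.1 (not_le.1 h)
  have h₂ := μ.monotone_sizeUpTo h₁
  have h₃ := μ.lt_sizeUpTo_index_succ q
  have h₄ := μ.sizeUpTo_index_le p
  have h₅ : (p : ℕ) ≤ q := hpq
  rw [Fin.val_succ] at h₃
  omega

/-- If `ν` refines `μ`, each block of `ν` lies in a block of `μ`. -/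
theorem Refines.index_eq (h : Refines ν μ) {p q : Fin n} (hpq : ν.index p = ν.index q) :
    μ.index p = μ.index q := by
  have aux : ∀ p q : Fin n, ν.index p = ν.index q → ¬ μ.index p < μ.index q := by
    intro p q hpq hlt
    -- the end of the `μ`-block of `p` separates `p` from `q`, and it is also a boundary of `ν`
    have hb : μ.boundary (μ.index p).succ ∈ μ.boundaries := by simp [Composition.boundaries]
    obtain ⟨k, -, hk⟩ := Finset.mem_map.1 (h hb)
    have hk' : ν.sizeUpTo k = μ.sizeUpTo ((μ.index p : ℕ) + 1) := by
      simpa [Composition.boundary] using congrArg Fin.val hk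
    have h₁ := μ.lt_sizeUpTo_index_succ p
    have h₂ := μ.monotone_sizeUpTo (show (μ.index p : ℕ) + 1 ≤ μ.index q from hlt)
    have h₃ := μ.sizeUpTo_index_le q
    have h₄ := ν.sizeUpTo_index_le p
    have h₅ := ν.lt_sizeUpTo_index_succ q
    rw [Fin.val_succ] at h₁ h₅
    have h₆ : (ν.index p : ℕ) < k := by
      by_contra hc
      have := ν.monotone_sizeUpTo (not_lt.1 hc)
      omega
    have h₇ := ν.monotone_sizeUpTo (show (ν.index p : ℕ) + 1 ≤ k from h₆)
    rw [hpq] at h₇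
    omega
  exact le_antisymm (not_lt.1 (aux q p hpq.symm)) (not_lt.1 (aux p q hpq))

theorem IncreasingOnBlocks.lt_iff (hu : IncreasingOnBlocks μ u) {p q : Fin n}
    (h : μ.index p = μ.index q) : u p < u q ↔ p < q := by
  refine ⟨fun hlt => ?_, fun hlt => hu p q hlt h⟩
  by_contra hle
  rcases (not_lt.1 hle).lt_or_eq with hqp | rfl
  · exact hlt.not_gt (hu q p hqp h.symm)
  · exact lt_irrefl _ hlt

theorem increasingOnBlocks_one : IncreasingOnBlocks μ 1 := fun _ _ h _ => h

theorem preservesBlocks_one : PreservesBlocks μ 1 := fun _ => rfl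

theorem PreservesBlocks.inv (h : PreservesBlocks μ σ) : PreservesBlocks μ σ⁻¹ := fun p => by
  simpa using (h (σ⁻¹ p)).symm

theorem PreservesBlocks.mul (hσ : PreservesBlocks μ σ) (hτ : PreservesBlocks μ τ) :
    PreservesBlocks μ (σ * τ) := fun p => (hσ (τ p)).trans (hτ p)

theorem preservesBlocks_simple {j : Fin (n - 1)} (hj : μ.index (lo j) = μ.index (hi j)) :
    PreservesBlocks μ (simple j) := by
  intro p
  rw [simple, Equiv.swap_apply_def]
  split_ifs with h₁ h₂
  · rw [h₁, hj]
  · rw [h₂, hj]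
  · rfl

theorem PreservesBlocks.heckeLeft {j : Fin (n - 1)} (hσ : PreservesBlocks μ σ)
    (hj : μ.index (lo j) = μ.index (hi j)) : PreservesBlocks μ (heckeLeft j σ) := by
  unfold MuInv.heckeLeft
  split_ifs
  · exact (preservesBlocks_simple hj).mul hσ
  · exact hσ

theorem PreservesBlocks.heckeRight {j : Fin (n - 1)} (hσ : PreservesBlocks μ σ)
    (hj : μ.index (lo j) = μ.index (hi j)) : PreservesBlocks μ (heckeRight σ j) := by
  unfold MuInv.heckeRight
  split_ifs
  · exact hσ.mul (preservesBlocks_simple hj)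
  · exact hσ

/-- A permutation that preserves the blocks and is increasing on each of them is increasing. -/
theorem eq_one_of_preservesBlocks (hu : IncreasingOnBlocks μ u) (hp : PreservesBlocks μ u) :
    u = 1 := by
  have hmono : StrictMono u := by
    intro p q hpq
    rcases (index_mono μ hpq.le).lt_or_eq with h | h
    · by_contra hle
      have := index_mono μ (not_lt.1 hle)
      rw [hp, hp] at this
      exact h.not_ge this
    · exact hu p q hpq h
  have hid := Subsingleton.elim (hmono.orderIsoOfSurjective u u.surjective) (OrderIso.refl _)
  ext p
  exact congrArg Fin.val (DFunLike.congr_fun hid p)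

/-- The factorization of a permutation into a minimal coset representative and an element of the
Young subgroup is unique. -/
theorem factorization_unique (hu : IncreasingOnBlocks μ u) (hv : IncreasingOnBlocks μ v)
    (hσ : PreservesBlocks μ σ) (hτ : PreservesBlocks μ τ) (h : u * σ = v * τ) :
    u = v ∧ σ = τ := by
  have hg : PreservesBlocks μ (τ * σ⁻¹) := hτ.mul hσ.inv
  have hu' : u = v * (τ * σ⁻¹) := by rw [← mul_assoc, ← h]; group
  have h1 : τ * σ⁻¹ = 1 := by
    refine eq_one_of_preservesBlocks (fun p q hpq hi => ?_) hg
    have := hu p q hpq hi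
    rw [hu'] at this
    exact (hv.lt_iff (by rw [hg, hg, hi])).1 this
  exact ⟨by rw [hu', h1, mul_one], (mul_inv_eq_one.1 h1).symm⟩

/-! ### The standardizations of the blocks as a block-preserving permutation -/

theorem relPos_apply_embedding (μ : Composition n) (π : Equiv.Perm (Fin n)) (j : Fin μ.length)
    (a : Fin (μ.blocksFun j)) :
    relPos μ π (π (μ.embedding j a)) = μ.embedding j (std (block μ π j) a) :=
  relPos_eq μ π _ j a rfl

theorem index_relPos (μ : Composition n) (π : Equiv.Perm (Fin n)) (p : Fin n) :
    μ.index (relPos μ π (π p)) = μ.index p := by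
  obtain ⟨a, ha⟩ := μ.mem_range_embedding p
  conv_lhs => rw [← ha]
  rw [relPos_apply_embedding, μ.index_embedding]

theorem relPos_lt_relPos (μ : Composition n) (π : Equiv.Perm (Fin n)) {p q : Fin n}
    (h : μ.index p = μ.index q) :
    relPos μ π (π p) < relPos μ π (π q) ↔ π p < π q := by
  obtain ⟨a, ha⟩ := μ.mem_range_embedding p
  obtain ⟨b, hb⟩ : q ∈ Set.range (μ.embedding (μ.index p)) := h ▸ μ.mem_range_embedding q
  conv_lhs => rw [← ha, ← hb]
  rw [relPos_apply_embedding, relPos_apply_embedding, OrderEmbedding.lt_iff_lt,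
    std_lt_std (block_injective μ π _), block, block, ha, hb]

theorem relPos_injective (μ : Composition n) (π : Equiv.Perm (Fin n)) :
    Function.Injective fun p => relPos μ π (π p) := by
  intro p q h
  have hi : μ.index p = μ.index q := by
    rw [← index_relPos μ π p, ← index_relPos μ π q]
    exact congrArg μ.index h
  have h₁ := (relPos_lt_relPos μ π hi).not.1 (show relPos μ π (π p) = _ from h).not_lt
  have h₂ := (relPos_lt_relPos μ π hi.symm).not.1 (show relPos μ π (π p) = _ from h).not_gt
  exact π.injective (le_antisymm (not_lt.1 h₂) (not_lt.1 h₁))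

/-- The permutation that acts on the positions of each block of `π` by the standardization of that
block. It is the component of `π` in the Young subgroup of `μ`. -/
noncomputable def blockStd (μ : Composition n) (π : Equiv.Perm (Fin n)) : Equiv.Perm (Fin n) :=
  Equiv.ofBijective _ (Finite.injective_iff_bijective.1 (relPos_injective μ π))

theorem blockStd_apply (μ : Composition n) (π : Equiv.Perm (Fin n)) (p : Fin n) :
    blockStd μ π p = relPos μ π (π p) := rfl

theorem preservesBlocks_blockStd (μ : Composition n) (π : Equiv.Perm (Fin n)) :
    PreservesBlocks μ (blockStd μ π) := index_relPos μ π

theorem increasingOnBlocks_mul_inv_blockStd (μ : Composition n) (π : Equiv.Perm (Fin n)) :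
    IncreasingOnBlocks μ (π * (blockStd μ π)⁻¹) := by
  intro p q hpq hi
  have hi' : μ.index ((blockStd μ π)⁻¹ p) = μ.index ((blockStd μ π)⁻¹ q) := by
    rw [(preservesBlocks_blockStd μ π).inv, (preservesBlocks_blockStd μ π).inv, hi]
  have := (relPos_lt_relPos μ π hi').1
  rw [← blockStd_apply, ← blockStd_apply] at this
  exact this (by simpa using hpq)

theorem blockStd_mul (hu : IncreasingOnBlocks μ u) (hσ : PreservesBlocks μ σ) :
    blockStd μ (u * σ) = σ :=
  (factorization_unique (increasingOnBlocks_mul_inv_blockStd μ (u * σ)) hu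
    (preservesBlocks_blockStd μ _) hσ (by group)).2

theorem relPos_mul (hu : IncreasingOnBlocks μ u) (hσ : PreservesBlocks μ σ) (x : Fin n) :
    relPos μ (u * σ) x = u⁻¹ x := by
  have h := blockStd_apply μ (u * σ) ((u * σ)⁻¹ x)
  rw [blockStd_mul hu hσ, apply_inv_apply] at h
  rw [← h]
  simp

theorem blockOf_mul (hσ : PreservesBlocks μ σ) (x : Fin n) :
    blockOf μ (u * σ) x = μ.index (u⁻¹ x) := by
  rw [blockOf, mul_inv_rev, Equiv.Perm.mul_apply, hσ.inv]

theorem mul_mem_muInvolutions (hu : IncreasingOnBlocks μ u) (hσ : PreservesBlocks μ σ)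
    (h : σ⁻¹ = σ) : u * σ ∈ muInvolutions μ := by
  intro j
  have key : ∀ a, μ.embedding j (std (block μ (u * σ) j) a) = σ (μ.embedding j a) := fun a => by
    rw [← relPos_apply_embedding, ← blockStd_apply, blockStd_mul hu hσ]
  rw [inv_eq_iff_mul_eq_one]
  ext a
  refine congrArg Fin.val ((μ.embedding j).injective ?_)
  rw [Equiv.Perm.mul_apply, key, key, ← Equiv.Perm.mul_apply, inv_eq_iff_mul_eq_one.1 h]
  rfl

/-! ### The action of a letter on a factored permutation -/

/-- If `i` and `i+1` are values of `u` in the same block, then they are values at adjacent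
positions. -/
theorem exists_simple_of_index_eq (hu : IncreasingOnBlocks μ u) {i : Fin (n - 1)}
    (h : μ.index (u⁻¹ (lo i)) = μ.index (u⁻¹ (hi i))) :
    ∃ j : Fin (n - 1), u (lo j) = lo i ∧ u (hi j) = hi i := by
  have hlt : u⁻¹ (lo i) < u⁻¹ (hi i) := by
    rw [← hu.lt_iff h]
    simpa using lo_lt_hi i
  have hb := (u⁻¹ (hi i)).isLt
  have hadj : (u⁻¹ (hi i) : ℕ) = (u⁻¹ (lo i) : ℕ) + 1 := by
    by_contra hne
    have hlt' : (u⁻¹ (lo i) : ℕ) < u⁻¹ (hi i) := hlt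
    -- a position strictly between would carry a value strictly between `i` and `i+1`
    let r : Fin n := ⟨(u⁻¹ (lo i) : ℕ) + 1, by omega⟩
    have h₁ : u⁻¹ (lo i) < r := Fin.lt_def.2 (by simp [r])
    have h₂ : r < u⁻¹ (hi i) := Fin.lt_def.2 (by simp only [r]; omega)
    have hr : μ.index (u⁻¹ (lo i)) = μ.index r :=
      le_antisymm (index_mono μ h₁.le) (h ▸ index_mono μ h₂.le)
    have k₁ := hu _ _ h₁ hr
    have k₂ := hu _ _ h₂ (hr.symm.trans h)
    rw [apply_inv_apply, Fin.lt_def] at k₁ k₂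
    rw [coe_lo] at k₁
    rw [coe_hi] at k₂
    omega
  refine ⟨⟨u⁻¹ (lo i), by omega⟩, ?_, ?_⟩
  · exact apply_inv_apply u (lo i)
  · have : hi ⟨(u⁻¹ (lo i) : ℕ), by omega⟩ = u⁻¹ (hi i) := Fin.ext hadj.symm
    rw [this, apply_inv_apply]

theorem heckeLeft_mul_of_adjacent {i j : Fin (n - 1)} (hlo : u (lo j) = lo i)
    (hhi : u (hi j) = hi i) (σ : Equiv.Perm (Fin n)) :
    heckeLeft i (u * σ) = u * heckeLeft j σ := by
  have hlo' : u⁻¹ (lo i) = lo j := by rw [← hlo]; simp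
  have hhi' : u⁻¹ (hi i) = hi j := by rw [← hhi]; simp
  simp only [heckeLeft, mul_inv_rev, Equiv.Perm.mul_apply, hlo', hhi']
  split_ifs
  · rw [← mul_assoc, simple_mul_eq_mul_simple hlo hhi, mul_assoc]
  · rfl

/-- The order of positions in different blocks is the order of the blocks, so it is not changed by
block-preserving permutations. -/
theorem PreservesBlocks.lt_iff (hσ : PreservesBlocks μ σ) {p q : Fin n}
    (h : μ.index p ≠ μ.index q) : σ p < σ q ↔ p < q := by
  have aux : ∀ {p q : Fin n}, μ.index p ≠ μ.index q → (p < q ↔ μ.index p < μ.index q) :=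
    fun h => ⟨fun hlt => lt_of_le_of_ne (index_mono μ hlt.le) h,
      fun hlt => lt_of_not_ge fun hle => hlt.not_ge (index_mono μ hle)⟩
  rw [aux h, aux (by rwa [hσ, hσ]), hσ, hσ]

theorem heckeLeft_mul_of_index_ne (hσ : PreservesBlocks μ σ) {i : Fin (n - 1)}
    (h : μ.index (u⁻¹ (lo i)) ≠ μ.index (u⁻¹ (hi i))) :
    heckeLeft i (u * σ) = heckeLeft i u * σ := by
  simp only [heckeLeft, mul_inv_rev, Equiv.Perm.mul_apply, hσ.inv.lt_iff h]
  split_ifs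
  · rw [mul_assoc]
  · rfl

theorem IncreasingOnBlocks.heckeLeft (hu : IncreasingOnBlocks μ u) {i : Fin (n - 1)}
    (h : μ.index (u⁻¹ (lo i)) ≠ μ.index (u⁻¹ (hi i))) : IncreasingOnBlocks μ (heckeLeft i u) := by
  unfold MuInv.heckeLeft
  split_ifs
  · intro p q hpq hi
    refine (simple_lt_simple ?_ ?_).2 (hu p q hpq hi)
    · rintro ⟨h₁, h₂⟩; exact h (by rw [← h₁, ← h₂]; simpa using hi)
    · rintro ⟨h₁, h₂⟩; exact h (by rw [← h₁, ← h₂]; simpa using hi.symm)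
  · exact hu

theorem muAct_mul_of_index_ne (hσ : PreservesBlocks μ σ) {i : Fin (n - 1)}
    (h : μ.index (u⁻¹ (lo i)) ≠ μ.index (u⁻¹ (hi i))) :
    muAct μ (u * σ) i = heckeLeft i u * σ := by
  rw [muAct, dif_neg (by rwa [blockOf_mul hσ, blockOf_mul hσ]), heckeLeft_mul_of_index_ne hσ h]

theorem muAct_mul_of_adjacent (hu : IncreasingOnBlocks μ u) (hσ : PreservesBlocks μ σ)
    {i j : Fin (n - 1)} (hlo : u (lo j) = lo i) (hhi : u (hi j) = hi i)
    (h : μ.index (lo j) = μ.index (hi j)) :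
    muAct μ (u * σ) i = u * heckeLeft j (heckeRight σ j) := by
  have hlo' : u⁻¹ (lo i) = lo j := by rw [← hlo]; simp
  have hhi' : u⁻¹ (hi i) = hi j := by rw [← hhi]; simp
  have hb : blockOf μ (u * σ) (lo i) = blockOf μ (u * σ) (hi i) := by
    rw [blockOf_mul hσ, blockOf_mul hσ, hlo', hhi', h]
  have hj : (⟨relPos μ (u * σ) (lo i), relPos_lt μ _ i hb⟩ : Fin (n - 1)) = j := by
    apply Fin.ext
    simp only [relPos_mul hu hσ, hlo', coe_lo]
  have hr : heckeRight (u * σ) j = u * heckeRight σ j := by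
    have := hu.lt_iff (p := σ (lo j)) (q := σ (hi j)) (by rw [hσ, hσ, h])
    simp only [heckeRight, Equiv.Perm.mul_apply, this]
    split_ifs
    · rw [mul_assoc]
    · rfl
  rw [muAct, dif_pos hb, hj, hr, heckeLeft_mul_of_adjacent hlo hhi]

/-! ### The action of words -/

theorem muWordAct_concat (μ : Composition n) (a : List (Fin (n - 1))) (i : Fin (n - 1)) :
    muWordAct μ (a ++ [i]) = muAct μ (muWordAct μ a) i := by
  simp [muWordAct]

theorem muWordAct_append (μ : Composition n) (a b : List (Fin (n - 1))) :
    muWordAct μ (a ++ b) = b.foldl (muAct μ) (muWordAct μ a) :=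
  List.foldl_append

/-- All letters of the word `p` exchange two positions in the same block of `μ`. -/
def IsBlockWord (μ : Composition n) (p : List (Fin (n - 1))) : Prop :=
  ∀ j ∈ p, μ.index (lo j) = μ.index (hi j)

theorem isBlockWord_concat {p : List (Fin (n - 1))} {j : Fin (n - 1)} :
    IsBlockWord μ (p ++ [j]) ↔ IsBlockWord μ p ∧ μ.index (lo j) = μ.index (hi j) := by
  simp [IsBlockWord, or_imp, forall_and]

theorem IsBlockWord.preservesBlocks_leftEval {p : List (Fin (n - 1))} (hp : IsBlockWord μ p) :
    PreservesBlocks μ (leftEval p 1) := by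
  induction p using List.reverseRecOn with
  | nil => exact preservesBlocks_one
  | append_singleton p j ih =>
    rw [isBlockWord_concat] at hp
    rw [leftEval_concat]
    exact (ih hp.1).heckeLeft hp.2

theorem IsBlockWord.preservesBlocks_conjEval {p : List (Fin (n - 1))} (hp : IsBlockWord μ p) :
    PreservesBlocks μ (conjEval p) := by
  induction p using List.reverseRecOn with
  | nil => exact preservesBlocks_one
  | append_singleton p j ih =>
    rw [isBlockWord_concat] at hp
    rw [conjEval_concat]
    exact ((ih hp.1).heckeRight hp.2).heckeLeft hp.2

/-- On the Young subgroup of `μ`, the action is 0-Hecke conjugation. -/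
theorem IsBlockWord.muWordAct_eq {p : List (Fin (n - 1))} (hp : IsBlockWord μ p) :
    muWordAct μ p = conjEval p := by
  induction p using List.reverseRecOn with
  | nil => rfl
  | append_singleton p j ih =>
    rw [isBlockWord_concat] at hp
    have h := muAct_mul_of_adjacent increasingOnBlocks_one hp.1.preservesBlocks_conjEval
      (i := j) (j := j) rfl rfl hp.2
    rw [muWordAct_concat, ih hp.1, conjEval_concat]
    simpa using h

/-- Let `x` be the 0-Hecke product of the word `a`, with the letters acting from the left, and
factor `x = u v` with `u` increasing on the blocks of `μ` and `v` in the Young subgroup. Then the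
`μ`-action of `a` on the identity gives `u (v ∘ v⁻¹)`. The factors come with words: `p` is a word
for `v`, and `q` is a word for `u` such that the product `u σ` is length-additive for all `σ` in
the Young subgroup. -/
theorem exists_factorization (μ : Composition n) (a : List (Fin (n - 1))) :
    ∃ (u : Equiv.Perm (Fin n)) (p q : List (Fin (n - 1))),
      IncreasingOnBlocks μ u ∧ IsBlockWord μ p ∧ leftEval a 1 = u * leftEval p 1 ∧
        muWordAct μ a = u * conjEval p ∧ ∀ σ, PreservesBlocks μ σ → leftEval q σ = u * σ := by
  induction a using List.reverseRecOn with
  | nil =>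
    exact ⟨1, [], [], increasingOnBlocks_one, by simp [IsBlockWord], by simp [leftEval],
      by simp [muWordAct, conjEval], by simp [leftEval]⟩
  | append_singleton a i ih =>
    obtain ⟨u, p, q, hu, hp, hx, ha, hq⟩ := ih
    rw [leftEval_concat, muWordAct_concat, hx, ha]
    by_cases h : μ.index (u⁻¹ (lo i)) = μ.index (u⁻¹ (hi i))
    · obtain ⟨j, hlo, hhi⟩ := exists_simple_of_index_eq hu h
      have hj : μ.index (lo j) = μ.index (hi j) := by
        rw [← hlo, ← hhi] at h
        simpa using h
      refine ⟨u, p ++ [j], q, hu, isBlockWord_concat.2 ⟨hp, hj⟩, ?_, ?_, hq⟩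
      · rw [heckeLeft_mul_of_adjacent hlo hhi, leftEval_concat]
      · rw [muAct_mul_of_adjacent hu hp.preservesBlocks_conjEval hlo hhi hj, conjEval_concat]
    · refine ⟨heckeLeft i u, p, q ++ [i], hu.heckeLeft h, hp, ?_, ?_, fun σ hσ => ?_⟩
      · exact heckeLeft_mul_of_index_ne hp.preservesBlocks_leftEval h
      · exact muAct_mul_of_index_ne hp.preservesBlocks_conjEval h
      · rw [leftEval_concat, hq σ hσ, heckeLeft_mul_of_index_ne hσ h]

theorem muWordAct_mem_muInvolutions (μ : Composition n) (a : List (Fin (n - 1))) :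
    muWordAct μ a ∈ muInvolutions μ := by
  obtain ⟨u, p, q, hu, hp, -, ha, -⟩ := exists_factorization μ a
  rw [ha]
  exact mul_mem_muInvolutions hu hp.preservesBlocks_conjEval (conjEval_inv p)

/-- The `μ`-action of a word only depends on its 0-Hecke product. -/
theorem muWordAct_congr (μ : Composition n) {a b : List (Fin (n - 1))}
    (h : leftEval a 1 = leftEval b 1) : muWordAct μ a = muWordAct μ b := by
  obtain ⟨u, p, -, hu, hp, hx, ha, -⟩ := exists_factorization μ a
  obtain ⟨u', p', -, hu', hp', hx', hb, -⟩ := exists_factorization μ b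
  rw [hx, hx'] at h
  obtain ⟨rfl, hv⟩ := factorization_unique hu hu' hp.preservesBlocks_leftEval
    hp'.preservesBlocks_leftEval h
  rw [ha, hb, conjEval_congr hv]

theorem IsBlockWord.of_refines (h : Refines ν μ) {p : List (Fin (n - 1))}
    (hp : IsBlockWord ν p) : IsBlockWord μ p := fun j hj => h.index_eq (hp j hj)

/-- If `ν` refines `μ`, the `ν`-action of a word on the identity determines its `μ`-action: there
is an equivariant map from the orbit of the identity for `ν` to the one for `μ`. -/
theorem muWordAct_eq_of_refines (h : Refines ν μ) {a b : List (Fin (n - 1))}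
    (hab : muWordAct ν a = muWordAct ν b) : muWordAct μ a = muWordAct μ b := by
  obtain ⟨u, p, q, hu, hp, hx, ha, hq⟩ := exists_factorization ν a
  obtain ⟨u', p', -, hu', hp', hx', hb, -⟩ := exists_factorization ν b
  rw [ha, hb] at hab
  obtain ⟨rfl, hc⟩ := factorization_unique hu hu' hp.preservesBlocks_conjEval
    hp'.preservesBlocks_conjEval hab
  -- `a` and `b` may be replaced by the words `p ++ q` and `p' ++ q`, with a common second part
  have ha' : muWordAct μ a = muWordAct μ (p ++ q) := muWordAct_congr μ <| by
    rw [leftEval_append, hq _ hp.preservesBlocks_leftEval, hx]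
  have hb' : muWordAct μ b = muWordAct μ (p' ++ q) := muWordAct_congr μ <| by
    rw [leftEval_append, hq _ hp'.preservesBlocks_leftEval, hx']
  rw [ha', hb', muWordAct_append, muWordAct_append, (hp.of_refines h).muWordAct_eq,
    (hp'.of_refines h).muWordAct_eq, hc]

/-! ### Atoms -/

theorem muWordAct_congr_of_mem_reducedWords (μ : Composition n) {a b : List (Fin (n - 1))}
    {w : Equiv.Perm (Fin n)} (ha : a ∈ reducedWords w) (hb : b ∈ reducedWords w) :
    muWordAct μ a = muWordAct μ b :=
  muWordAct_congr μ <| by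
    rw [leftEval_one_of_mem_reducedWords ha, leftEval_one_of_mem_reducedWords hb]

/-- A permutation is an atom of at most one element. -/
theorem eq_of_mem_atoms {w π π' : Equiv.Perm (Fin n)} (h : w ∈ atoms μ π)
    (h' : w ∈ atoms μ π') : π = π' := by
  obtain ⟨a, ha, haπ, -⟩ := h
  obtain ⟨b, hb, hbπ, -⟩ := h'
  rw [← haπ, ← hbπ, muWordAct_congr_of_mem_reducedWords μ ha hb]

/-- Each `μ`-atom of `π` is a `ν`-atom of some `τ` below `π`, namely of the result of the
`ν`-action of a reduced word. -/
theorem exists_mem_atoms_of_refines (h : Refines ν μ) {w π : Equiv.Perm (Fin n)}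
    (hw : w ∈ atoms μ π) : ∃ τ ∈ muInvolutions ν, AtomLE ν τ μ π ∧ w ∈ atoms ν τ := by
  obtain ⟨a, ha, haπ, hmin⟩ := hw
  have hred : a ∈ reducedMuWords ν (muWordAct ν a) :=
    ⟨rfl, fun b hb => hmin b ((muWordAct_eq_of_refines h hb).trans haπ)⟩
  refine ⟨muWordAct ν a, muWordAct_mem_muInvolutions ν a, ⟨h, ?_⟩, a, ha, hred⟩
  rintro w' ⟨b, hb, hbτ, hbmin⟩
  refine ⟨b, hb, (muWordAct_eq_of_refines h hbτ).trans haπ, fun c hc => ?_⟩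
  exact (hbmin a rfl).trans (hmin c hc)

theorem pairwiseDisjoint_atoms (ν : Composition n) (S : Set (Equiv.Perm (Fin n))) :
    S.PairwiseDisjoint (atoms ν) := fun _ _ _ _ hne =>
  Set.disjoint_left.2 fun _ h h' => hne (eq_of_mem_atoms h h')

/-- The `μ`-atoms of `π` are the `ν`-atoms of the elements below `π`. -/
theorem atoms_eq_iUnion (h : Refines ν μ) (π : Equiv.Perm (Fin n)) :
    atoms μ π = ⋃ τ ∈ {τ | τ ∈ muInvolutions ν ∧ AtomLE ν τ μ π}, atoms ν τ := by
  ext w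
  simp only [Set.mem_iUnion, exists_prop, Set.mem_ofPred_eq]
  constructor
  · intro hw
    obtain ⟨τ, hτ, hle, hwτ⟩ := exists_mem_atoms_of_refines h hw
    exact ⟨τ, ⟨hτ, hle⟩, hwτ⟩
  · rintro ⟨τ, ⟨-, hle⟩, hwτ⟩
    exact hle.2 hwτ

theorem inverseAtoms_eq_preimage (μ : Composition n) (π : Equiv.Perm (Fin n)) :
    inverseAtoms μ π = Inv.inv ⁻¹' atoms μ π := by
  ext v
  constructor
  · rintro ⟨w, hw, rfl⟩
    simpa using hw
  · intro hv
    exact ⟨v⁻¹, hv, (inv_inv v).symm⟩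

end MuInv

theorem theorem3p6 {n : ℕ} (μ ν : Composition n) (hνμ : MuInv.Refines ν μ)
    (π : Equiv.Perm (Fin n)) (hπ : π ∈ MuInv.muInvolutions μ) :
    MuInv.muSchubert μ π =
        ∑ τ ∈ (Set.toFinite {τ | τ ∈ MuInv.muInvolutions ν ∧ MuInv.AtomLE ν τ μ π}).toFinset,
          MuInv.muSchubert ν τ ∧
      MuInv.inverseAtoms μ π =
        ⋃ τ ∈ {τ | τ ∈ MuInv.muInvolutions ν ∧ MuInv.AtomLE ν τ μ π}, MuInv.inverseAtoms ν τ ∧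
      {τ | τ ∈ MuInv.muInvolutions ν ∧ MuInv.AtomLE ν τ μ π}.PairwiseDisjoint
        (MuInv.inverseAtoms ν) := by
  classical
  refine ⟨?_, ?_, ?_⟩
  · unfold MuInv.muSchubert
    rw [← Finset.sum_biUnion]
    · refine Finset.sum_congr ?_ fun _ _ => rfl
      ext w
      have := Set.ext_iff.1 (MuInv.atoms_eq_iUnion hνμ π) w
      simpa using this
    · intro τ _ τ' _ hne
      have := MuInv.pairwiseDisjoint_atoms ν Set.univ trivial trivial hne
      simpa [Function.onFun, Set.Finite.disjoint_toFinset] using this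
  · simp only [MuInv.inverseAtoms_eq_preimage]
    rw [MuInv.atoms_eq_iUnion hνμ π]
    simp only [Set.preimage_iUnion]
  · intro τ hτ τ' hτ' hne
    simp only [Function.onFun, MuInv.inverseAtoms_eq_preimage]
    exact (MuInv.pairwiseDisjoint_atoms ν _ hτ hτ' hne).preimage _
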